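/- Let $r\ge 2$ be an integer. For pairwise distinct $b_1,\dots,b_r>0$ and $\vec n=(n_1,\dots,n_r)\in\mathbb{N}_0^r$ with $|\vec n|=n_1+\cdots+n_r$, the multiple Charlier polynomial $C_{\vec n}$ with parameters $(b_1,\dots,b_r)$ is the unique monic polynomial of degree $|\vec n|$ such that $$\sum_{k=0}^\infty C_{\vec n}(k)\,k^\ell\,\frac{b_j^k}{k!}=0,\qquad \ell=0,1,\dots,n_j-1,\quad j=1,\dots,r .$$ **Theorem 3.** Let $a_1,\dots,a_r>0$ with $a_1,\dots,a_{r-1}$ pairwise distinct, let $0<q_j<1$ for $1\le j\le r$ with $\sum_{j=1}^r q_j=1$, and let $t>0$. For positive integers $n,N$ put $\vec n=(\lfloor q_1n\rfloor,\dots,\lfloor q_rn\rfloor)$, and let $C_{\vec n}$ and $C_{\vec n+\vec e_k}$ be the multiple Charlier polynomials with parameters $(a_1,\dots,a_{r-1},Na_r)$ (which are pairwise distinct for all large $N$), where $\vec e_k$ is the $k$th unit vector. Then $$\lim_{n,N\to\infty,\ n/N\to t}\frac{C_{\vec n+\vec e_r}(Nx)}{N\,C_{\vec n}(Nx)}=g_r(x):=\frac{x-a_r-t+\sqrt{(x-a_r-t)^2-4a_rq_rt}}{2},$$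 and, for every $1\le k<r$, $$\lim_{n,N\to\infty,\ n/N\to t}\frac{C_{\vec n+\vec e_k}(Nx)}{N\,C_{\vec n}(Nx)}=x-t-\frac{a_rq_rt}{g_r(x)},$$ both uniformly for $x$ in every compact subset of $\mathbb{C}\setminus[0,\infty)$. Here the square root is the branch that is analytic on $\mathbb{C}\setminus[\alpha,\beta]$, with $\alpha,\beta=a_r+t\mp2\sqrt{a_rq_rt}$ (so $0<\alpha<\beta$), and behaves like $x$ as $x\to\infty$. -/

import Mathlib

open Polynomial Filter Topology

/-- `P` is monic of degree `|n| = n_1 + ⋯ + n_r` and satisfies, for every `j`, the `n_j`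
orthogonality conditions `∑_{k ≥ 0} P(k) k^ℓ a_j^k / k! = 0`, `0 ≤ ℓ ≤ n_j - 1`
(the series always converge; here `0 ^ 0 = 1`). -/
def IsMultipleCharlier {r : ℕ} (a : Fin r → ℝ) (n : Fin r → ℕ) (P : ℝ[X]) : Prop :=
  P.Monic ∧ P.natDegree = ∑ j, n j ∧
    ∀ j : Fin r, ∀ ℓ : ℕ, ℓ < n j →
      HasSum (fun k : ℕ => P.eval (k : ℝ) * (k : ℝ) ^ ℓ * (a j ^ k / (k.factorial : ℝ))) 0

/-- The multiple Charlier polynomial `C_n` with parameters `a_1, …, a_r`: the polynomial that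
satisfies `IsMultipleCharlier a n`. For positive, pairwise distinct parameters there is exactly
one such polynomial; nothing is claimed about other parameters. -/
noncomputable def multipleCharlier {r : ℕ} (a : Fin r → ℝ) (n : Fin r → ℕ) : ℝ[X] :=
  Classical.epsilon (IsMultipleCharlier a n)

/-- The parameters `(a_1, …, a_{r-1}, N a_r)`, where `r = m + 1`. -/
noncomputable def scaledParams {m : ℕ} (a : Fin (m + 1) → ℝ) (N : ℕ) : Fin (m + 1) → ℝ :=
  Function.update a (Fin.last m) ((N : ℝ) * a (Fin.last m))

/-- The multi-index `(⌊q_1 n⌋, …, ⌊q_r n⌋)`. -/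
noncomputable def floorIndex {r : ℕ} (q : Fin r → ℝ) (n : ℕ) : Fin r → ℕ :=
  fun j => ⌊q j * (n : ℝ)⌋₊

/-- The ratio `C_{n + e_k}(N x) / (N C_n(N x))` of neighbouring multiple Charlier polynomials with
multi-index `(⌊q_1 n⌋, …, ⌊q_r n⌋)` and parameters `(a_1, …, a_{r-1}, N a_r)`. -/
noncomputable def charlierRatio {m : ℕ} (a q : Fin (m + 1) → ℝ) (k : Fin (m + 1))
    (n N : ℕ) (x : ℂ) : ℂ :=
  aeval ((N : ℂ) * x) (multipleCharlier (scaledParams a N) (floorIndex q n + Pi.single k 1)) /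
    ((N : ℂ) * aeval ((N : ℂ) * x) (multipleCharlier (scaledParams a N) (floorIndex q n)))

/-- The limit `n, N → ∞`, `n / N → t`, as a filter on pairs `(n, N)`. -/
noncomputable def ratioFilter (t : ℝ) : Filter (ℕ × ℕ) :=
  (atTop ×ˢ atTop) ⊓ comap (fun p : ℕ × ℕ => (p.1 : ℝ) / (p.2 : ℝ)) (𝓝 t)

/-- The set `ℂ ∖ [0, ∞)`. -/
def complexOffNonneg : Set ℂ := ((fun y : ℝ => (y : ℂ)) '' Set.Ici 0)ᶜ

/-- For `c > 0`, the branch of `√(w² - c)` that is analytic on `ℂ ∖ [-√c, √c]` and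
satisfies `√(w² - c) / w → 1` as `w → ∞`. It is written with the principal square root of
`1 - c / w²`, whose argument lies on the cut `(-∞, 0]` only for `w` real and `0 < |w| ≤ √c`. -/
noncomputable def sqrtAtInfinity (c : ℝ) (w : ℂ) : ℂ :=
  w * (1 - (c : ℂ) / w ^ 2) ^ (1 / 2 : ℂ)

theorem sqrtAtInfinity_sq (c : ℝ) {w : ℂ} (hw : w ≠ 0) :
    sqrtAtInfinity c w ^ 2 = w ^ 2 - (c : ℂ) := by
  have h : ((1 - (c : ℂ) / w ^ 2) ^ (1 / 2 : ℂ)) ^ 2 = 1 - (c : ℂ) / w ^ 2 := by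
    simp
  rw [sqrtAtInfinity, mul_pow, h]
  field_simp

/-- `g(x) = (x - α - t + √((x - α - t)² - 4 α κ t)) / 2`. -/
noncomputable def ratioLimit (α κ t : ℝ) (x : ℂ) : ℂ :=
  ((x - (α : ℂ) - (t : ℂ)) + sqrtAtInfinity (4 * α * κ * t) (x - (α : ℂ) - (t : ℂ))) / 2

/-! Falling factorials have Poisson sums `b ^ k * exp b`, so the umbral map turns orthogonality at
`b` into vanishing at `b`: `C_n` is the image of `∏ (X - b_j) ^ n_j`. Multiplication by `x` pulls
back to `P ↦ X (P + P')`. Applied to this product, it shows that `Q_n = C_{n + e_k} / C_n + b_k`,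
which does not depend on `k`, satisfies `Q_n = z - ∑ n_j Q_{n - e_j} / (Q_{n - e_j} - b_j)`.

For `z` off `[0, ∞)` this recurrence preserves the set of all `u z - v` with `u ≥ 1`, `v ≥ 0`, which
keeps a positive distance from `[0, ∞)` (`charlierQuot_mem`). Hence no denominator vanishes, and the
quotients in the sum are bounded.

After division by `N`, the parameters `a_j / N`, `j < r`, tend to `0`, so only the direction `e_r`
survives. Along an ultrafilter, `Q_{n - i e_r} / N` has a limit `L_i` for every `i`, and `G_i = L_i
- a_r` is a backward orbit of the Möbius map `G ↦ x - a_r - t - a_r q_r t / G`. Its fixed points are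
`g` and `h`, with `|h| < |g|`. Since `h + a_r` lies outside the closed sector
(`ratioLimitConj_add_notMem`), the orbit stays away from the repelling point, which forces `G_0 = g`
(`eq_of_backward_orbit`). -/

/-! ### The umbral map and Poisson sums -/

/-- The umbral map: the linear map of `ℝ[X]` that sends `X ^ k` to the falling factorial
`x (x - 1) ⋯ (x - k + 1)`. -/
noncomputable def fallingMap : ℝ[X] →ₗ[ℝ] ℝ[X] :=
  Polynomial.lsum fun k => (LinearMap.id : ℝ →ₗ[ℝ] ℝ).smulRight (descPochhammer ℝ k)

theorem fallingMap_monomial (k : ℕ) (c : ℝ) :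
    fallingMap (monomial k c) = c • descPochhammer ℝ k := by
  simp [fallingMap, Polynomial.lsum_apply, Polynomial.sum_monomial_index]

theorem fallingMap_one : fallingMap 1 = 1 := by
  rw [← monomial_zero_one, fallingMap_monomial]; simp

/-- Under the umbral map, `P ↦ X (P + P')` corresponds to multiplication by `X`. -/
noncomputable def mulXConj : ℝ[X] →ₗ[ℝ] ℝ[X] :=
  LinearMap.mulLeft ℝ (X : ℝ[X]) ∘ₗ (LinearMap.id + Polynomial.derivative)

theorem mulXConj_apply (P : ℝ[X]) : mulXConj P = X * (P + derivative P) := rfl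

/-- On monomials this is `x · (x)_k = (x)_{k+1} + k (x)_k` for falling factorials `(x)_k`. -/
theorem fallingMap_mulXConj (P : ℝ[X]) : fallingMap (mulXConj P) = X * fallingMap P := by
  induction P using Polynomial.induction_on' with
  | add p q hp hq => simp only [map_add, hp, hq, mul_add]
  | monomial k c =>
    rw [mulXConj_apply, mul_add, X_mul_monomial, derivative_monomial, X_mul_monomial, map_add,
      fallingMap_monomial, fallingMap_monomial, fallingMap_monomial, descPochhammer_succ_right]
    cases k with
    | zero => simp
    | succ k =>
      simp only [Nat.add_sub_cancel, smul_eq_C_mul, map_mul, map_natCast]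
      ring

theorem fallingMap_mulXConj_iterate (P : ℝ[X]) (l : ℕ) :
    fallingMap (mulXConj^[l] P) = X ^ l * fallingMap P := by
  induction l with
  | zero => simp
  | succ l ih => rw [Function.iterate_succ_apply', fallingMap_mulXConj, ih]; ring

theorem fallingMap_surjective : Function.Surjective fallingMap := by
  intro Q
  induction Q using Polynomial.induction_on' with
  | add p q hp hq =>
    obtain ⟨p', rfl⟩ := hp
    obtain ⟨q', rfl⟩ := hq
    exact ⟨p' + q', map_add _ _ _⟩
  | monomial k c =>
    refine ⟨c • mulXConj^[k] 1, ?_⟩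
    rw [map_smul, fallingMap_mulXConj_iterate, fallingMap_one, mul_one, smul_X_eq_monomial]

/-- The umbral map is unitriangular, because every falling factorial is monic. -/
theorem degree_fallingMap_sub_lt {P : ℝ[X]} {d : ℕ} (hP : P.degree < (d + 1 : ℕ)) :
    (fallingMap P - P).degree < d := by
  rw [P.as_sum_range' (d + 1) (by
    by_cases h : P = 0
    · simp [h]
    · exact (natDegree_lt_iff_degree_lt h).2 hP), map_sum, ← Finset.sum_sub_distrib]
  refine lt_of_le_of_lt (degree_sum_le _ _) ((Finset.sup_lt_iff (WithBot.bot_lt_coe d)).2 ?_)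
  intro k hk
  have hk : k ≤ d := Nat.lt_succ_iff.1 (Finset.mem_range.1 hk)
  rw [fallingMap_monomial, ← smul_X_eq_monomial, ← smul_sub]
  refine lt_of_le_of_lt (degree_smul_le _ _) ?_
  have hdeg : (descPochhammer ℝ k).degree = k := by
    rw [degree_eq_natDegree (monic_descPochhammer ℝ k).ne_zero, descPochhammer_natDegree]
  have h := degree_sub_lt_left (p := descPochhammer ℝ k) (q := X ^ k) (by rw [hdeg, degree_X_pow])
    (monic_descPochhammer ℝ k).ne_zero
    (by rw [(monic_descPochhammer ℝ k).leadingCoeff, leadingCoeff_X_pow])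
  rw [hdeg] at h
  exact h.trans_le (Nat.cast_le.2 hk)

theorem fallingMap_degree_leadingCoeff (P : ℝ[X]) :
    (fallingMap P).natDegree = P.natDegree ∧ (fallingMap P).leadingCoeff = P.leadingCoeff := by
  by_cases h : P = 0
  · simp [h]
  have hlt : (fallingMap P - P).degree < P.degree := by
    rw [degree_eq_natDegree h]
    refine degree_fallingMap_sub_lt ?_
    rw [degree_eq_natDegree h]
    exact_mod_cast Nat.lt_succ_self _
  have he : fallingMap P = (fallingMap P - P) + P := by ring
  constructor
  · rw [he]; exact natDegree_eq_of_degree_eq (degree_add_eq_right_of_degree_lt hlt)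
  · rw [he]; exact leadingCoeff_add_of_degree_lt hlt

/-- The first `m` terms vanish, and cancelling factorials in the rest leaves `b ^ m` times the
exponential series. -/
theorem hasSum_descPochhammer (m : ℕ) (b : ℝ) :
    HasSum (fun k : ℕ => (descPochhammer ℝ m).eval (k : ℝ) * (b ^ k / (k.factorial : ℝ)))
      (b ^ m * Real.exp b) := by
  rw [← hasSum_nat_add_iff' m]
  have h0 : ∑ i ∈ Finset.range m,
      (descPochhammer ℝ m).eval (i : ℝ) * (b ^ i / (i.factorial : ℝ)) = 0 := by
    refine Finset.sum_eq_zero fun i hi => ?_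
    rw [descPochhammer_eval_eq_descFactorial, Nat.descFactorial_of_lt (Finset.mem_range.1 hi)]
    simp
  rw [h0, sub_zero]
  have h := (NormedSpace.expSeries_div_hasSum_exp (𝔸 := ℝ) b).mul_left (b ^ m)
  rw [← Real.exp_eq_exp_ℝ] at h
  refine (congrArg (HasSum · _) (funext fun k => ?_)).mpr h
  rw [descPochhammer_eval_eq_descFactorial]
  have h1 := Nat.factorial_mul_descFactorial (Nat.le_add_left m k)
  rw [Nat.add_sub_cancel] at h1
  rw [← h1]
  have h2 : ((k.factorial : ℕ) : ℝ) ≠ 0 := by positivity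
  have h3 : (((k + m).descFactorial m : ℕ) : ℝ) ≠ 0 := by
    have : (k + m).descFactorial m ≠ 0 := by
      intro h; rw [h, mul_zero] at h1; exact (Nat.factorial_ne_zero _) h1.symm
    exact_mod_cast this
  push_cast
  field_simp
  ring

theorem hasSum_fallingMap (P : ℝ[X]) (b : ℝ) :
    HasSum (fun k : ℕ => (fallingMap P).eval (k : ℝ) * (b ^ k / (k.factorial : ℝ)))
      (P.eval b * Real.exp b) := by
  induction P using Polynomial.induction_on' with
  | add p q hp hq => simpa only [map_add, eval_add, add_mul] using hp.add hq
  | monomial m c =>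
    have h := (hasSum_descPochhammer m b).mul_left c
    simpa only [fallingMap_monomial, eval_smul, smul_eq_mul, eval_monomial, mul_assoc] using h

theorem hasSum_fallingMap_mul_pow (P : ℝ[X]) (b : ℝ) (l : ℕ) :
    HasSum (fun k : ℕ => (fallingMap P).eval (k : ℝ) * (k : ℝ) ^ l *
      (b ^ k / (k.factorial : ℝ))) ((mulXConj^[l] P).eval b * Real.exp b) := by
  have h := hasSum_fallingMap (mulXConj^[l] P) b
  rw [fallingMap_mulXConj_iterate] at h
  simpa only [eval_mul, eval_pow, eval_X, mul_comm, mul_left_comm, mul_assoc] using h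

theorem hasSum_fallingMap_mul_pow_zero_iff (P : ℝ[X]) (b : ℝ) (l : ℕ) :
    HasSum (fun k : ℕ => (fallingMap P).eval (k : ℝ) * (k : ℝ) ^ l *
      (b ^ k / (k.factorial : ℝ))) 0 ↔ (mulXConj^[l] P).eval b = 0 := by
  have h := hasSum_fallingMap_mul_pow P b l
  constructor
  · intro h0
    exact (mul_eq_zero.1 (h.unique h0)).resolve_right (Real.exp_ne_zero b)
  · intro h0
    rwa [h0, zero_mul] at h

/-! ### Orthogonality as divisibility by powers of `X - b` -/

/-- One differentiation costs at most one order of vanishing. -/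
theorem pow_dvd_mulXConj {P : ℝ[X]} {b : ℝ} {n : ℕ} (h : (X - C b) ^ (n + 1) ∣ P) :
    (X - C b) ^ n ∣ mulXConj P := by
  rw [mulXConj_apply]
  refine Dvd.dvd.mul_left (dvd_add ((pow_dvd_pow _ n.le_succ).trans h) ?_) _
  simpa using pow_sub_one_dvd_derivative_of_pow_dvd h

theorem eval_mulXConj_iterate_of_dvd {P : ℝ[X]} {b : ℝ} {n : ℕ} (h : (X - C b) ^ n ∣ P)
    {l : ℕ} (hl : l < n) : (mulXConj^[l] P).eval b = 0 := by
  induction l generalizing P n with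
  | zero =>
    exact (dvd_iff_isRoot.1 ((dvd_pow_self _ (by omega)).trans h))
  | succ l ih =>
    obtain ⟨n, rfl⟩ : ∃ k, n = k + 1 := ⟨n - 1, by omega⟩
    exact ih (pow_dvd_mulXConj h) (by omega)

/-- Induction on `n`, applied both to `P` and to `mulXConj P`: since `b ≠ 0`, the factor `X` can be
cancelled, so `(X - b) ^ n` divides `P'`. As `b` is a root of `P`, its multiplicity in `P` is one
more than in `P'`. -/
theorem dvd_of_eval_mulXConj_iterate {P : ℝ[X]} {b : ℝ} (hb : b ≠ 0) {n : ℕ}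
    (h : ∀ l < n, (mulXConj^[l] P).eval b = 0) : (X - C b) ^ n ∣ P := by
  induction n generalizing P with
  | zero => simp
  | succ n ih =>
    by_cases hP : P = 0
    · simp [hP]
    have h1 : (X - C b) ^ n ∣ P := ih fun l hl => h l (by omega)
    have h2 : (X - C b) ^ n ∣ X * (P + derivative P) :=
      ih (P := mulXConj P) fun l hl => h (l + 1) (by omega)
    have hcop : IsCoprime ((X - C b) ^ n) (X : ℝ[X]) := by
      have := (isCoprime_X_sub_C_of_isUnit_sub (R := ℝ) (a := b) (b := 0)
        (by simpa using hb)).pow_left (m := n)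
      simpa using this
    have h3 : (X - C b) ^ n ∣ derivative P := by
      have := dvd_sub (hcop.dvd_of_dvd_mul_left h2) h1
      simpa using this
    have hroot : P.IsRoot b := h 0 (by omega)
    have hd : derivative P ≠ 0 := by
      intro h0
      have hc := derivative_eq_zero.1 h0
      rw [eq_C_of_natDegree_eq_zero hc] at hroot hP
      simp only [IsRoot, eval_C] at hroot
      simp [hroot] at hP
    have h4 := (le_rootMultiplicity_iff hd).2 h3
    rw [derivative_rootMultiplicity_of_root hroot] at h4
    have h5 := (rootMultiplicity_pos hP).2 hroot
    exact (le_rootMultiplicity_iff hP).1 (by omega)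

/-- The polynomial `∏ (X - b_j) ^ n_j`, whose umbral image is the multiple Charlier polynomial. -/
noncomputable def umbra {r : ℕ} (b : Fin r → ℝ) (n : Fin r → ℕ) : ℝ[X] :=
  ∏ j, (X - C (b j)) ^ n j

theorem umbra_monic {r : ℕ} (b : Fin r → ℝ) (n : Fin r → ℕ) : (umbra b n).Monic :=
  monic_prod_of_monic _ _ fun j _ => (monic_X_sub_C (b j)).pow (n j)

theorem umbra_natDegree {r : ℕ} (b : Fin r → ℝ) (n : Fin r → ℕ) :
    (umbra b n).natDegree = ∑ j, n j := by
  rw [umbra, natDegree_prod_of_monic _ _ fun j _ => (monic_X_sub_C (b j)).pow (n j)]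
  simp

theorem isMultipleCharlier_fallingMap_umbra {r : ℕ} (b : Fin r → ℝ) (n : Fin r → ℕ) :
    IsMultipleCharlier b n (fallingMap (umbra b n)) := by
  obtain ⟨h1, h2⟩ := fallingMap_degree_leadingCoeff (umbra b n)
  refine ⟨h2.trans (umbra_monic b n), h1.trans (umbra_natDegree b n), fun j l hl => ?_⟩
  rw [hasSum_fallingMap_mul_pow_zero_iff]
  exact eval_mulXConj_iterate_of_dvd (Finset.dvd_prod_of_mem (fun j => (X - C (b j)) ^ n j)
    (Finset.mem_univ j)) hl

/-- The preimage of `Q` is divisible by the pairwise coprime factors, hence by their product, which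
is monic of the same degree. -/
theorem IsMultipleCharlier.eq_fallingMap_umbra {r : ℕ} {b : Fin r → ℝ} {n : Fin r → ℕ}
    (hb : ∀ j, b j ≠ 0) (hinj : Function.Injective b) {Q : ℝ[X]}
    (hQ : IsMultipleCharlier b n Q) : Q = fallingMap (umbra b n) := by
  obtain ⟨P, rfl⟩ := fallingMap_surjective Q
  obtain ⟨hm, hd, ho⟩ := hQ
  obtain ⟨h1, h2⟩ := fallingMap_degree_leadingCoeff P
  have hdvd : umbra b n ∣ P := by
    refine Finset.prod_dvd_of_coprime ?_ fun j _ => ?_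
    · intro i _ j _ hij
      exact (isCoprime_X_sub_C_of_isUnit_sub
        (sub_ne_zero.2 (hinj.ne hij)).isUnit).pow
    · refine dvd_of_eval_mulXConj_iterate (hb j) fun l hl => ?_
      rw [← hasSum_fallingMap_mul_pow_zero_iff]
      exact ho j l hl
  have hPm : P.Monic := h2.symm.trans hm
  rw [eq_of_monic_of_dvd_of_natDegree_le (umbra_monic b n) hPm hdvd
    (by rw [← h1, hd, umbra_natDegree])]

theorem multipleCharlier_eq {r : ℕ} {b : Fin r → ℝ} (hb : ∀ j, b j ≠ 0)
    (hinj : Function.Injective b) (n : Fin r → ℕ) :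
    multipleCharlier b n = fallingMap (umbra b n) :=
  (Classical.epsilon_spec (p := IsMultipleCharlier b n)
    ⟨_, isMultipleCharlier_fallingMap_umbra b n⟩).eq_fallingMap_umbra hb hinj

/-! ### The recurrence for quotients of neighbouring polynomials -/

theorem umbra_add_single {r : ℕ} (b : Fin r → ℝ) (n : Fin r → ℕ) (k : Fin r) :
    umbra b (n + Pi.single k 1) = (X - C (b k)) * umbra b n := by
  simp only [umbra, Pi.add_apply, pow_add, Finset.prod_mul_distrib]
  rw [mul_comm]
  congr 1
  rw [Finset.prod_eq_single k]
  · simp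
  · intro j _ hj
    simp [Pi.single_eq_of_ne hj]
  · simp

theorem sub_single_add_single {r : ℕ} {n : Fin r → ℕ} {j : Fin r} (hj : n j ≠ 0) :
    n - Pi.single j 1 + Pi.single j 1 = n := by
  refine tsub_add_cancel_of_le fun i => ?_
  by_cases h : i = j
  · subst h; simpa using Nat.one_le_iff_ne_zero.2 hj
  · simp [Pi.single_eq_of_ne h]

/-- Where `n j = 0` the subtraction truncates, but the coefficient is zero. -/
theorem derivative_umbra {r : ℕ} (b : Fin r → ℝ) (n : Fin r → ℕ) :
    derivative (umbra b n) = ∑ j, (n j : ℝ) • umbra b (n - Pi.single j 1) := by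
  rw [umbra, derivative_prod_finset]
  refine Finset.sum_congr rfl fun j _ => ?_
  have hj : (∏ i ∈ Finset.univ.erase j, (X - C (b i)) ^ n i) * (X - C (b j)) ^ (n j - 1) =
      umbra b (n - Pi.single j 1) := by
    rw [umbra, ← Finset.prod_erase_mul _ _ (Finset.mem_univ j)]
    congr 1
    · refine Finset.prod_congr rfl fun i hi => ?_
      simp [Pi.single_eq_of_ne (Finset.ne_of_mem_erase hi)]
    · simp
  rw [← hj, derivative_X_sub_C_pow, smul_eq_C_mul]
  simp only [map_natCast]
  ring

/-- Evaluation at `z` of the umbral image. -/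
noncomputable def fallingEval (z : ℂ) : ℝ[X] →ₗ[ℝ] ℂ :=
  (aeval z).toLinearMap ∘ₗ fallingMap

theorem fallingEval_apply (z : ℂ) (P : ℝ[X]) : fallingEval z P = aeval z (fallingMap P) := rfl

theorem fallingEval_X_mul_add (z : ℂ) (P : ℝ[X]) :
    fallingEval z (X * P) + fallingEval z (X * derivative P) = z * fallingEval z P := by
  rw [← map_add, ← mul_add, ← mulXConj_apply, fallingEval_apply, fallingMap_mulXConj, map_mul,
    aeval_X, fallingEval_apply]

/-- The quotient `z C_n(z - 1) / C_n(z)`, which differs from `C_{n + e_k}(z) / C_n(z)` by the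
constant `b_k`. -/
noncomputable def charlierQuot {r : ℕ} (b : Fin r → ℝ) (z : ℂ) (n : Fin r → ℕ) : ℂ :=
  fallingEval z (X * umbra b n) / fallingEval z (umbra b n)

theorem fallingEval_umbra_add_single {r : ℕ} {b : Fin r → ℝ} {z : ℂ} {n : Fin r → ℕ}
    (h : fallingEval z (umbra b n) ≠ 0) (k : Fin r) :
    fallingEval z (umbra b (n + Pi.single k 1)) =
      (charlierQuot b z n - b k) * fallingEval z (umbra b n) := by
  rw [umbra_add_single, sub_mul, sub_mul, map_sub, charlierQuot, div_mul_cancel₀ _ h,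
    ← smul_eq_C_mul, map_smul, Complex.real_smul]

/-- Divide the umbral identity for `X (P + P')` by the image of `P = umbra b n`. The product rule
for `P'` yields the images of `X * umbra b (n - e_j)`, and both numerator and denominator are
multiples of the image of `umbra b (n - e_j)`. -/
theorem charlierQuot_eq {r : ℕ} {b : Fin r → ℝ} {z : ℂ} {n : Fin r → ℕ}
    (h : ∀ j, n j ≠ 0 → fallingEval z (umbra b (n - Pi.single j 1)) ≠ 0)
    (hn : fallingEval z (umbra b n) ≠ 0) :
    charlierQuot b z n = z - ∑ j, (n j : ℂ) * (charlierQuot b z (n - Pi.single j 1) /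
      (charlierQuot b z (n - Pi.single j 1) - b j)) := by
  have h0 := fallingEval_X_mul_add z (umbra b n)
  rw [derivative_umbra, Finset.mul_sum, map_sum] at h0
  have h1 : ∀ j, fallingEval z (X * (n j : ℝ) • umbra b (n - Pi.single j 1)) =
      (n j : ℂ) * (charlierQuot b z (n - Pi.single j 1) /
      (charlierQuot b z (n - Pi.single j 1) - b j)) * fallingEval z (umbra b n) := by
    intro j
    rw [mul_smul_comm, map_smul, Complex.real_smul, Complex.ofReal_natCast]
    by_cases hj : n j = 0
    · simp [hj]
    have h2 := fallingEval_umbra_add_single (h j hj) j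
    rw [sub_single_add_single hj] at h2
    have h3 : charlierQuot b z (n - Pi.single j 1) - b j ≠ 0 := by
      intro h3; rw [h3, zero_mul] at h2; exact hn h2
    rw [h2, mul_assoc, ← mul_assoc (_ / _), div_mul_cancel₀ _ h3, charlierQuot,
      div_mul_cancel₀ _ (h j hj)]
  simp only [h1] at h0
  rw [← Finset.sum_mul] at h0
  rw [charlierQuot, div_eq_iff hn, sub_mul, ← h0, add_sub_cancel_right]

/-! ### The invariant sector -/

/-- The translate by `x` of the convex cone generated by `x` and `-1`. -/
def shiftedSector (x : ℂ) : Set ℂ := {y | ∃ u v : ℝ, 1 ≤ u ∧ 0 ≤ v ∧ y = u * x - v}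

theorem mul_sub_mem_complexOffNonneg {x : ℂ} (hx : x ∈ complexOffNonneg) {u v : ℝ} (hu : 0 < u)
    (hv : 0 ≤ v) : (u : ℂ) * x - v ≠ 0 := by
  intro h
  refine hx ⟨v / u, div_nonneg hv hu.le, ?_⟩
  have hu' : (u : ℂ) ≠ 0 := by exact_mod_cast hu.ne'
  push_cast
  rw [div_eq_iff hu', mul_comm x]
  linear_combination -h

theorem self_mem_shiftedSector (x : ℂ) : x ∈ shiftedSector x :=
  ⟨1, 0, le_rfl, le_rfl, by simp⟩

theorem sub_ne_zero_of_mem_shiftedSector {x y : ℂ} (hx : x ∈ complexOffNonneg)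
    (hy : y ∈ shiftedSector x) {b : ℝ} (hb : 0 ≤ b) : y - b ≠ 0 := by
  obtain ⟨u, v, hu, hv, rfl⟩ := hy
  have := mul_sub_mem_complexOffNonneg hx (u := u) (v := v + b) (by linarith) (by linarith)
  push_cast at this
  rwa [← sub_sub] at this

/-- Since `y / (y - b) = (|y|² - b y) / |y - b|²`, subtracting `c` times it adds a nonnegative
multiple of `y` and subtracts a nonnegative real. Writing `y = u x - v` gives the new coefficients.
-/
theorem sub_mul_div_mem_shiftedSector {x w y : ℂ} (hx : x ∈ complexOffNonneg)
    (hw : w ∈ shiftedSector x) (hy : y ∈ shiftedSector x) {b : ℝ} (hb : 0 ≤ b) {c : ℝ}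
    (hc : 0 ≤ c) : w - c * (y / (y - b)) ∈ shiftedSector x := by
  have h0 := sub_ne_zero_of_mem_shiftedSector hx hy hb
  obtain ⟨u', v', hu', hv', rfl⟩ := hw
  obtain ⟨u, v, hu, hv, hyu⟩ := hy
  have hn : 0 < Complex.normSq (y - b) := Complex.normSq_pos.2 h0
  refine ⟨u' + c * (b * u / Complex.normSq (y - b)),
    v' + c * ((Complex.normSq y + b * v) / Complex.normSq (y - b)), ?_, ?_, ?_⟩
  · have : 0 ≤ c * (b * u / Complex.normSq (y - b)) := by positivity
    linarith
  · have := Complex.normSq_nonneg y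
    positivity
  · have hconj : (starRingEnd ℂ) (y - b) ≠ 0 := (_root_.map_ne_zero _).2 h0
    have hy2 : (y : ℂ) / (y - b) =
        ((Complex.normSq y : ℂ) - b * y) / (Complex.normSq (y - b) : ℂ) := by
      rw [← Complex.mul_conj, ← Complex.mul_conj, div_eq_div_iff h0 (mul_ne_zero h0 hconj)]
      simp only [map_sub, Complex.conj_ofReal]
      ring
    have hn' : (Complex.normSq (y - b) : ℂ) ≠ 0 := by exact_mod_cast hn.ne'
    rw [hy2]
    push_cast
    field_simp
    linear_combination (c * b : ℂ) * hyu

/-- Membership of `y j` is asked only where `c j ≠ 0`: in the application `n - e_j` truncates to `n`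
itself when `n_j = 0`, out of reach of the induction. -/
theorem sub_sum_mem_shiftedSector {ι : Type*} {x : ℂ} (hx : x ∈ complexOffNonneg)
    (s : Finset ι) (c b : ι → ℝ) (y : ι → ℂ) (hc : ∀ j ∈ s, 0 ≤ c j) (hb : ∀ j ∈ s, 0 ≤ b j)
    (hy : ∀ j ∈ s, c j ≠ 0 → y j ∈ shiftedSector x) :
    x - ∑ j ∈ s, (c j : ℂ) * (y j / (y j - b j)) ∈ shiftedSector x := by
  classical
  induction s using Finset.induction_on with
  | empty => simpa using self_mem_shiftedSector x
  | insert i s hi ih =>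
    rw [Finset.sum_insert hi, add_comm, ← sub_sub]
    have hw := ih (fun j hj => hc j (Finset.mem_insert_of_mem hj))
      (fun j hj => hb j (Finset.mem_insert_of_mem hj))
      (fun j hj => hy j (Finset.mem_insert_of_mem hj))
    by_cases h : c i = 0
    · simpa [h] using hw
    · exact sub_mul_div_mem_shiftedSector hx hw (hy i (Finset.mem_insert_self i s) h)
        (hb i (Finset.mem_insert_self i s)) (hc i (Finset.mem_insert_self i s))

/-- Both claims are proved together by induction on `|n|`: the sector at `n - e_j` excludes `b_j`,
so passing to `n` multiplies by a nonzero factor; the recurrence then places the quotient at `n` in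
the sector. -/
theorem charlierQuot_mem {r : ℕ} {b : Fin r → ℝ} (hb : ∀ j, 0 < b j) {z : ℂ}
    (hz : z ∈ complexOffNonneg) (n : Fin r → ℕ) :
    fallingEval z (umbra b n) ≠ 0 ∧ charlierQuot b z n ∈ shiftedSector z := by
  induction hs : ∑ j, n j using Nat.strong_induction_on generalizing n with
  | _ s ih =>
    subst hs
    have hlt : ∀ j, n j ≠ 0 → fallingEval z (umbra b (n - Pi.single j 1)) ≠ 0 ∧
        charlierQuot b z (n - Pi.single j 1) ∈ shiftedSector z := by
      intro j hj
      refine ih _ ?_ _ rfl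
      conv_rhs => rw [← sub_single_add_single hj]
      simp [Finset.sum_add_distrib]
    have hn : fallingEval z (umbra b n) ≠ 0 := by
      by_cases h0 : n = 0
      · subst h0
        have : fallingEval z (umbra b 0) = 1 := by
          simp [umbra, fallingEval_apply, fallingMap_one]
        simp [this]
      · obtain ⟨j, hj⟩ : ∃ j, n j ≠ 0 := by
          by_contra! h
          exact h0 (funext h)
        have := fallingEval_umbra_add_single (hlt j hj).1 j
        rw [sub_single_add_single hj] at this
        rw [this]
        exact mul_ne_zero (sub_ne_zero_of_mem_shiftedSector hz (hlt j hj).2 (hb j).le) (hlt j hj).1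
    refine ⟨hn, ?_⟩
    rw [charlierQuot_eq (fun j hj => (hlt j hj).1) hn]
    have := sub_sum_mem_shiftedSector hz Finset.univ (fun j => (n j : ℝ)) b
      (fun j => charlierQuot b z (n - Pi.single j 1)) (fun j _ => Nat.cast_nonneg _)
      (fun j _ => (hb j).le) (fun j _ h => (hlt j (by exact_mod_cast h)).2)
    simpa only [Complex.ofReal_natCast] using this

/-! ### Uniform bounds and limits in the sector -/

theorem isClosed_image_ofReal_Ici : IsClosed ((fun y : ℝ => (y : ℂ)) '' Set.Ici 0) :=
  Complex.isometry_ofReal.isClosedEmbedding.isClosedMap _ isClosed_Ici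

theorem isOpen_complexOffNonneg : IsOpen complexOffNonneg :=
  isClosed_image_ofReal_Ici.isOpen_compl

/-- The distance of `x` from `[0, ∞)`. -/
noncomputable def distNonneg (x : ℂ) : ℝ :=
  Metric.infDist x ((fun y : ℝ => (y : ℂ)) '' Set.Ici 0)

theorem continuous_distNonneg : Continuous distNonneg := Metric.continuous_infDist_pt _

theorem distNonneg_pos {x : ℂ} (hx : x ∈ complexOffNonneg) : 0 < distNonneg x :=
  (isClosed_image_ofReal_Ici.notMem_iff_infDist_pos ⟨_, 0, Set.self_mem_Ici, rfl⟩).1 hx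

theorem mul_distNonneg_le {x : ℂ} {u v : ℝ} (hu : 0 < u) (hv : 0 ≤ v) :
    u * distNonneg x ≤ ‖(u : ℂ) * x - v‖ := by
  have h : distNonneg x ≤ dist x ((v / u : ℝ) : ℂ) :=
    Metric.infDist_le_dist_of_mem ⟨v / u, div_nonneg hv hu.le, rfl⟩
  have hu' : (u : ℂ) ≠ 0 := by exact_mod_cast hu.ne'
  have h2 : (u : ℂ) * x - v = u * (x - ((v / u : ℝ) : ℂ)) := by
    push_cast
    field_simp
  rw [h2, norm_mul, Complex.norm_real, Real.norm_of_nonneg hu.le, ← dist_eq_norm]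
  exact mul_le_mul_of_nonneg_left h hu.le

/-- This is where `u ≥ 1`, rather than `u > 0`, in the sector matters: the bound is uniform in `y`.
-/
theorem distNonneg_le_norm_sub {x y : ℂ} (hy : y ∈ shiftedSector x) {b : ℝ} (hb : 0 ≤ b) :
    distNonneg x ≤ ‖y - b‖ := by
  obtain ⟨u, v, hu, hv, rfl⟩ := hy
  have h := mul_distNonneg_le (x := x) (u := u) (v := v + b) (by linarith) (by linarith)
  push_cast at h
  rw [← sub_sub] at h
  have h0 : 0 ≤ distNonneg x := Metric.infDist_nonneg
  nlinarith

theorem norm_div_sub_sub_one_le {x y : ℂ} (hx : x ∈ complexOffNonneg) (hy : y ∈ shiftedSector x)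
    {b : ℝ} (hb : 0 ≤ b) : ‖y / (y - b) - 1‖ ≤ b / distNonneg x := by
  have h0 := sub_ne_zero_of_mem_shiftedSector hx hy hb
  have h1 : y / (y - b) - 1 = b / (y - b) := by field_simp; ring
  rw [h1, norm_div, Complex.norm_real, Real.norm_of_nonneg hb]
  exact div_le_div_of_nonneg_left hb (distNonneg_pos hx) (distNonneg_le_norm_sub hy hb)

theorem norm_div_sub_le {x y : ℂ} (hx : x ∈ complexOffNonneg) (hy : y ∈ shiftedSector x)
    {b : ℝ} (hb : 0 ≤ b) : ‖y / (y - b)‖ ≤ 1 + b / distNonneg x := by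
  have h := norm_div_sub_sub_one_le hx hy hb
  have h2 := norm_add_le (1 : ℂ) (y / (y - b) - 1)
  rw [add_sub_cancel, norm_one] at h2
  linarith

theorem exists_tendsto_of_eventually_norm_le {ι E : Type*} [NormedAddCommGroup E] [ProperSpace E]
    {U : Ultrafilter ι} {f : ι → E} {B : ℝ} (h : ∀ᶠ i in (U : Filter ι), ‖f i‖ ≤ B) :
    ∃ L, Tendsto f U (𝓝 L) := by
  obtain ⟨L, -, hL⟩ := (isCompact_closedBall (0 : E) B).ultrafilter_le_nhds' (U.map f)
    (Ultrafilter.mem_map.2 (by filter_upwards [h] with i hi; simpa using hi))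
  exact ⟨L, hL⟩

/-- The sector is closed even when its vertex moves. The coefficient `u` is bounded by `|y|` over
the distance of `x` from `[0, ∞)`, so it converges along the ultrafilter, and `v = u x - y`
converges with it. -/
theorem mem_shiftedSector_of_tendsto {ι : Type*} {U : Ultrafilter ι} {x y : ι → ℂ} {x₀ y₀ : ℂ}
    (hx₀ : x₀ ∈ complexOffNonneg) (hx : Tendsto x U (𝓝 x₀)) (hy : Tendsto y U (𝓝 y₀))
    (h : ∀ᶠ i in (U : Filter ι), y i ∈ shiftedSector (x i)) : y₀ ∈ shiftedSector x₀ := by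
  -- The pair of coefficients takes the dummy value `0` at indices where membership fails.
  have h' : ∀ i, ∃ p : ℝ × ℝ, y i ∈ shiftedSector (x i) →
      1 ≤ p.1 ∧ 0 ≤ p.2 ∧ y i = p.1 * x i - p.2 := by
    intro i
    by_cases hi : y i ∈ shiftedSector (x i)
    · obtain ⟨u, v, huv⟩ := hi
      exact ⟨(u, v), fun _ => huv⟩
    · exact ⟨0, fun h => absurd h hi⟩
  choose p hp using h'
  have hd := distNonneg_pos hx₀
  have hdx : ∀ᶠ i in (U : Filter ι), distNonneg x₀ / 2 < distNonneg (x i) :=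
    ((continuous_distNonneg.tendsto x₀).comp hx).eventually_const_lt (by linarith)
  have hyb : ∀ᶠ i in (U : Filter ι), ‖y i‖ < ‖y₀‖ + 1 :=
    hy.norm.eventually_lt_const (by linarith)
  obtain ⟨u₀, hu₀⟩ : ∃ L, Tendsto (fun i => (p i).1) U (𝓝 L) := by
    refine exists_tendsto_of_eventually_norm_le (B := (‖y₀‖ + 1) / (distNonneg x₀ / 2)) ?_
    filter_upwards [h, hdx, hyb] with i hi hdi hyi
    obtain ⟨h1, h2, h3⟩ := hp i hi
    have h4 := mul_distNonneg_le (x := x i) (u := (p i).1) (by linarith) h2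
    rw [← h3] at h4
    rw [Real.norm_of_nonneg (by linarith), le_div_iff₀ (by linarith)]
    nlinarith
  have hv₀ : Tendsto (fun i => ((p i).1 : ℂ) * x i - y i) U (𝓝 (u₀ * x₀ - y₀)) :=
    (((Complex.continuous_ofReal.tendsto u₀).comp hu₀).mul hx).sub hy
  have hv : Tendsto (fun i => ((p i).2 : ℂ)) U (𝓝 (u₀ * x₀ - y₀)) := by
    refine hv₀.congr' ?_
    filter_upwards [h] with i hi
    rw [(hp i hi).2.2]; ring
  have hre := (Complex.continuous_re.tendsto _).comp hv
  have him := (Complex.continuous_im.tendsto _).comp hv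
  simp only [Function.comp_def, Complex.ofReal_re] at hre
  simp only [Function.comp_def, Complex.ofReal_im] at him
  have him0 := tendsto_nhds_unique him tendsto_const_nhds
  refine ⟨u₀, (u₀ * x₀ - y₀).re, ?_, ?_, ?_⟩
  · refine ge_of_tendsto hu₀ ?_
    filter_upwards [h] with i hi using (hp i hi).1
  · refine ge_of_tendsto hre ?_
    filter_upwards [h] with i hi using (hp i hi).2.1
  · have : ((u₀ * x₀ - y₀).re : ℂ) = u₀ * x₀ - y₀ := Complex.ext (by simp) (by simp [him0])
    rw [this]; ring

theorem isClosed_shiftedSector {x : ℂ} (hx : x ∈ complexOffNonneg) :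
    IsClosed (shiftedSector x) := by
  rw [isClosed_iff_ultrafilter]
  intro y U hU hmem
  exact mem_shiftedSector_of_tendsto (x := fun _ => x) (y := id) hx tendsto_const_nhds hU hmem

/-! ### Backward orbits of a Möbius map -/

/-- A bounded backward orbit of the Möbius map `G ↦ g + h - g h / G` that stays away from its
repelling fixed point `h` is the attracting fixed point `g`. -/
theorem eq_of_backward_orbit {g h : ℂ} (hlt : ‖h‖ < ‖g‖) {G : ℕ → ℂ} {B δ : ℝ}
    (hG : ∀ i, G i ≠ 0) (hrec : ∀ i, G i = g + h - g * h / G (i + 1)) (hB : ∀ i, ‖G i‖ ≤ B)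
    (hδ : 0 < δ) (hGδ : ∀ i, δ ≤ ‖G i - h‖) : G 0 = g := by
  have hg : 0 < ‖g‖ := (norm_nonneg h).trans_lt hlt
  -- The map multiplies `(G - g) / (G - h)` by `h / g`; the identity is cross-multiplied so that
  -- nothing is divided by.
  have key : ∀ i, (G 0 - g) * (G i - h) * g ^ i = h ^ i * (G i - g) * (G 0 - h) := by
    intro i
    induction i with
    | zero => ring
    | succ i ih =>
      have h1 : G i * G (i + 1) = (g + h) * G (i + 1) - g * h := by
        rw [hrec i, sub_mul, div_mul_cancel₀ _ (hG (i + 1))]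
      apply mul_left_cancel₀ (hG i)
      have h2 : (G i - h) * G (i + 1) = g * (G (i + 1) - h) := by linear_combination h1
      have h3 : (G i - g) * G (i + 1) = h * (G (i + 1) - g) := by linear_combination h1
      rw [pow_succ, pow_succ]
      linear_combination G i * G (i + 1) * ih - G i * (G 0 - g) * g ^ i * h2
        + G i * h ^ i * (G 0 - h) * h3
  have hb : ∀ i : ℕ, ‖G 0 - g‖ * δ ≤ (‖h‖ / ‖g‖) ^ i * ((B + ‖g‖) * ‖G 0 - h‖) := by
    intro i
    have h1 := congrArg norm (key i)
    simp only [norm_mul, norm_pow] at h1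
    rw [div_pow, div_mul_eq_mul_div, le_div_iff₀ (by positivity)]
    calc ‖G 0 - g‖ * δ * ‖g‖ ^ i ≤ ‖G 0 - g‖ * ‖G i - h‖ * ‖g‖ ^ i := by
          have := hGδ i
          gcongr
      _ = ‖h‖ ^ i * ‖G i - g‖ * ‖G 0 - h‖ := h1
      _ ≤ ‖h‖ ^ i * (B + ‖g‖) * ‖G 0 - h‖ := by
          have := (norm_sub_le (G i) g).trans (add_le_add_left (hB i) _)
          gcongr
      _ = _ := by ring
  have hlim : Tendsto (fun i : ℕ => (‖h‖ / ‖g‖) ^ i * ((B + ‖g‖) * ‖G 0 - h‖)) atTop (𝓝 0) := by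
    simpa using (tendsto_pow_atTop_nhds_zero_of_lt_one (by positivity)
      ((div_lt_one hg).2 hlt)).mul_const ((B + ‖g‖) * ‖G 0 - h‖)
  have h0 : ‖G 0 - g‖ * δ ≤ 0 := ge_of_tendsto' hlim hb
  have h1 : ‖G 0 - g‖ ≤ 0 := by
    by_contra! hc
    have := mul_pos hc hδ
    linarith
  exact sub_eq_zero.1 (norm_le_zero_iff.1 h1)

/-! ### The fixed points and the branch of the square root -/

theorem re_cpow_half_pos {z : ℂ} (hz : z ∈ Complex.slitPlane) : 0 < (z ^ (1 / 2 : ℂ)).re := by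
  rw [Complex.cpow_def_of_ne_zero (Complex.slitPlane_ne_zero hz), Complex.exp_re]
  refine mul_pos (Real.exp_pos _) (Real.cos_pos_of_mem_Ioo ?_)
  have him : (Complex.log z * (1 / 2 : ℂ)).im = z.arg / 2 := by
    have : (1 / 2 : ℂ) = ((1 / 2 : ℝ) : ℂ) := by norm_num
    rw [this, Complex.im_mul_ofReal, Complex.log_im]; ring
  rw [him]
  have h1 := Complex.neg_pi_lt_arg z
  have h2 := (Complex.arg_le_pi z).lt_of_ne (Complex.mem_slitPlane_iff_arg.1 hz).1
  constructor <;> linarith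

/-- On the cut, `w = x - α - t` would be real with `w² ≤ 4 α κ t ≤ (α + t)²`, which puts `x = α + t
+ w` in `[0, ∞)`. -/
theorem one_sub_div_sq_mem_slitPlane {α κ t : ℝ} (hα : 0 < α) (hκ : 0 < κ) (hκ1 : κ < 1)
    (ht : 0 < t) {x : ℂ} (hx : x ∈ complexOffNonneg) :
    1 - ((4 * α * κ * t : ℝ) : ℂ) / (x - α - t) ^ 2 ∈ Complex.slitPlane := by
  by_contra hns
  rw [Complex.mem_slitPlane_iff] at hns
  push Not at hns
  obtain ⟨h1, h2⟩ := hns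
  set w := x - α - t with hw
  set z := ((4 * α * κ * t : ℝ) : ℂ) / w ^ 2 with hz
  have hzre : 1 ≤ z.re := by
    simp only [Complex.sub_re, Complex.one_re] at h1; linarith
  have hzim : z.im = 0 := by
    simp only [Complex.sub_im, Complex.one_im] at h2; linarith
  have hzr : z = (z.re : ℂ) := Complex.ext (by simp) (by simp [hzim])
  have hc : 0 < 4 * α * κ * t := by positivity
  have hw0 : w ^ 2 ≠ 0 := by
    intro h0
    rw [hz, h0, div_zero] at hzre
    simp at hzre
    linarith
  set σ := 4 * α * κ * t / z.re with hσ
  have hσ0 : 0 ≤ σ := by positivity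
  have hσ1 : σ ≤ 4 * α * κ * t := div_le_self hc.le hzre
  have hzne : (z.re : ℂ) ≠ 0 := by
    have : z.re ≠ 0 := by linarith
    exact_mod_cast this
  have hwσ : w ^ 2 = ((Real.sqrt σ : ℝ) : ℂ) ^ 2 := by
    rw [← Complex.ofReal_pow, Real.sq_sqrt hσ0, hσ, Complex.ofReal_div, eq_div_iff hzne, ← hzr, hz,
      mul_div_cancel₀ _ hw0]
  have hle : Real.sqrt σ ≤ α + t := by
    rw [Real.sqrt_le_left (by linarith)]
    nlinarith [sq_nonneg (α - t), mul_pos (mul_pos hα ht) (sub_pos.2 hκ1)]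
  rcases sq_eq_sq_iff_eq_or_eq_neg.1 hwσ with h | h
  · refine hx ⟨α + t + Real.sqrt σ, by simp only [Set.mem_Ici]; positivity, ?_⟩
    push_cast
    rw [← h, hw]; ring
  · refine hx ⟨α + t - Real.sqrt σ, by simp only [Set.mem_Ici]; linarith, ?_⟩
    push_cast
    linear_combination hw - h

/-- The other root `(w - √(w² - 4 α κ t)) / 2`, `w = x - α - t`, of the equation solved by
`ratioLimit α κ t x`. -/
noncomputable def ratioLimitConj (α κ t : ℝ) (x : ℂ) : ℂ :=
  ((x - (α : ℂ) - (t : ℂ)) - sqrtAtInfinity (4 * α * κ * t) (x - (α : ℂ) - (t : ℂ))) / 2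

theorem ratioLimit_add_conj (α κ t : ℝ) (x : ℂ) :
    ratioLimit α κ t x + ratioLimitConj α κ t x = x - α - t := by
  rw [ratioLimit, ratioLimitConj]; ring

theorem sub_sub_ne_zero {α t : ℝ} (hα : 0 < α) (ht : 0 < t) {x : ℂ}
    (hx : x ∈ complexOffNonneg) : x - α - t ≠ 0 := by
  have := sub_ne_zero_of_mem_shiftedSector hx (self_mem_shiftedSector x) (b := α + t) (by linarith)
  push_cast at this
  rwa [← sub_sub] at this

theorem ratioLimit_mul_conj {α κ t : ℝ} (hα : 0 < α) (ht : 0 < t) {x : ℂ}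
    (hx : x ∈ complexOffNonneg) :
    ratioLimit α κ t x * ratioLimitConj α κ t x = ((α * κ * t : ℝ) : ℂ) := by
  have h := sqrtAtInfinity_sq (4 * α * κ * t) (sub_sub_ne_zero hα ht hx)
  rw [ratioLimit, ratioLimitConj]
  push_cast at h ⊢
  linear_combination -h / 4

/-- The two roots are `w (1 ± s) / 2`, where `s` is a principal square root with positive real part,
hence `|1 - s| < |1 + s|`. -/
theorem norm_ratioLimitConj_lt {α κ t : ℝ} (hα : 0 < α) (hκ : 0 < κ) (hκ1 : κ < 1)
    (ht : 0 < t) {x : ℂ} (hx : x ∈ complexOffNonneg) :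
    ‖ratioLimitConj α κ t x‖ < ‖ratioLimit α κ t x‖ := by
  have hs := re_cpow_half_pos (one_sub_div_sq_mem_slitPlane hα hκ hκ1 ht hx)
  have hw := norm_pos_iff.2 (sub_sub_ne_zero hα ht hx)
  rw [ratioLimit, ratioLimitConj, sqrtAtInfinity]
  set w := x - α - t
  set s := (1 - ((4 * α * κ * t : ℝ) : ℂ) / w ^ 2) ^ (1 / 2 : ℂ)
  have h1 : w - w * s = w * (1 - s) := by ring
  have h2 : w + w * s = w * (1 + s) := by ring
  rw [h1, h2, norm_div, norm_div, norm_mul, norm_mul]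
  have h3 : ‖1 - s‖ < ‖1 + s‖ := by
    rw [← sq_lt_sq₀ (norm_nonneg _) (norm_nonneg _), ← Complex.normSq_eq_norm_sq,
      ← Complex.normSq_eq_norm_sq, Complex.normSq_apply, Complex.normSq_apply]
    simp only [Complex.sub_re, Complex.sub_im, Complex.add_re, Complex.add_im, Complex.one_re,
      Complex.one_im]
    nlinarith
  have h4 : (0 : ℝ) < ‖(2 : ℂ)‖ := by norm_num
  gcongr

/-- This keeps the backward orbit away from the repelling point. If `h + α = u x - v`, comparing
imaginary parts in `g + h = x - α - t` and `g h = α κ t` gives `((|g|² - α κ t) u + α κ t) Im x =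
0`. As `|g|² > α κ t`, `x` is real and negative, and then `h < -α` and `g < -α`, which is
impossible. -/
theorem ratioLimitConj_add_notMem {α κ t : ℝ} (hα : 0 < α) (hκ : 0 < κ) (hκ1 : κ < 1)
    (ht : 0 < t) {x : ℂ} (hx : x ∈ complexOffNonneg) :
    ratioLimitConj α κ t x + α ∉ shiftedSector x := by
  rintro ⟨u, v, hu, hv, hh⟩
  have hsum := ratioLimit_add_conj α κ t x
  have hmul := ratioLimit_mul_conj (κ := κ) hα ht hx
  have hlt := norm_ratioLimitConj_lt hα hκ hκ1 ht hx
  set g := ratioLimit α κ t x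
  set h := ratioLimitConj α κ t x
  have hlt2 : h.re * h.re + h.im * h.im < g.re * g.re + g.im * g.im := by
    rw [← Complex.normSq_apply, ← Complex.normSq_apply, Complex.normSq_eq_norm_sq,
      Complex.normSq_eq_norm_sq]
    exact (sq_lt_sq₀ (norm_nonneg _) (norm_nonneg _)).2 hlt
  have e1 := congrArg Complex.re hsum
  have e2 := congrArg Complex.im hsum
  have e3 := congrArg Complex.re hmul
  have e4 := congrArg Complex.im hmul
  have e5 := congrArg Complex.re hh
  have e6 := congrArg Complex.im hh
  simp only [Complex.add_re, Complex.add_im, Complex.sub_re, Complex.sub_im, Complex.mul_re,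
    Complex.mul_im, Complex.ofReal_re, Complex.ofReal_im] at e1 e2 e3 e4 e5 e6
  set M := g.re * g.re + g.im * g.im
  have hc : 0 < α * κ * t := by positivity
  have hM : h.im * M = -(α * κ * t) * g.im := by
    simp only [M]
    linear_combination g.re * e4 - g.im * e3
  have hM2 : (α * κ * t) ^ 2 = M * (h.re * h.re + h.im * h.im) := by
    rw [← e3]
    linear_combination -(g.re * h.im + g.im * h.re) * e4
  have hM0 : 0 ≤ M := add_nonneg (mul_self_nonneg _) (mul_self_nonneg _)
  have hcM : α * κ * t < M := by
    by_contra! hcon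
    nlinarith
  have hY : x.im = 0 := by
    have h1 : x.im * ((M - α * κ * t) * u + α * κ * t) = 0 := by
      have h2 : h.im = u * x.im := by linarith
      have h3 : g.im = (1 - u) * x.im := by linarith
      rw [h2, h3] at hM
      linear_combination hM
    rcases mul_eq_zero.1 h1 with h2 | h2
    · exact h2
    · nlinarith
  have hX : x.re < 0 := by
    by_contra! hcon
    exact hx ⟨x.re, hcon, Complex.ext (by simp) (by simp [hY])⟩
  have hk : h.im = 0 := by rw [hY] at e6; linarith
  have hr : g.im = 0 := by linarith
  rw [hk, hr] at e3
  have hsα : h.re < -α := by nlinarith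
  have hp : g.re < -α := by
    simp only [M, hk, hr] at hlt2
    by_contra! hcon
    rcases le_or_gt 0 g.re with h0 | h0
    · nlinarith
    · nlinarith
  -- The product `(g + α) (h + α)` equals `α (x - (1 - κ) t) < 0`, although both factors are
  -- negative.
  nlinarith [mul_pos (neg_pos.2 (sub_neg.2 hsα)) (neg_pos.2 (sub_neg.2 hp)), mul_pos hα ht,
    mul_pos hα (neg_pos.2 hX), mul_pos (mul_pos hα ht) (sub_pos.2 hκ1)]

theorem continuousAt_ratioLimit {α κ t : ℝ} (hα : 0 < α) (hκ : 0 < κ) (hκ1 : κ < 1)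
    (ht : 0 < t) {x : ℂ} (hx : x ∈ complexOffNonneg) :
    ContinuousAt (ratioLimit α κ t) x := by
  have hs := one_sub_div_sq_mem_slitPlane hα hκ hκ1 ht hx
  have hw := sub_sub_ne_zero hα ht hx
  unfold ratioLimit sqrtAtInfinity
  have h1 : ContinuousAt (fun x : ℂ => x - α - t) x := by fun_prop
  have h2 : ContinuousAt (fun x : ℂ =>
      (1 - ((4 * α * κ * t : ℝ) : ℂ) / (x - α - t) ^ 2) ^ (1 / 2 : ℂ)) x :=
    (continuousAt_const.sub (continuousAt_const.div (h1.pow 2) (pow_ne_zero 2 hw))).cpow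
      continuousAt_const hs
  exact (h1.add (h1.mul h2)).div_const 2

/-! ### Rescaling by `N` -/

theorem tendsto_floor_sub_div {ι : Type*} {l : Filter ι} {f g : ι → ℕ} {t q : ℝ} (hq : 0 ≤ q)
    (hg : Tendsto g l atTop) (hfg : Tendsto (fun i => (f i : ℝ) / g i) l (𝓝 t)) (k : ℕ) :
    Tendsto (fun i => ((⌊q * (f i : ℝ)⌋₊ - k : ℕ) : ℝ) / g i) l (𝓝 (q * t)) := by
  have hgr : Tendsto (fun i => (g i : ℝ)) l atTop := tendsto_natCast_atTop_atTop.comp hg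
  have hlow : Tendsto (fun i => q * ((f i : ℝ) / g i) - ((k : ℝ) + 1) / g i) l (𝓝 (q * t)) := by
    simpa using (hfg.const_mul q).sub (hgr.const_div_atTop ((k : ℝ) + 1))
  refine tendsto_of_tendsto_of_tendsto_of_le_of_le hlow (hfg.const_mul q) ?_ ?_
  · intro i
    have h1 := Nat.lt_floor_add_one (q * (f i : ℝ))
    have h2 : (⌊q * (f i : ℝ)⌋₊ : ℝ) ≤ ((⌊q * (f i : ℝ)⌋₊ - k : ℕ) : ℝ) + k := by
      exact_mod_cast le_tsub_add
    simp only
    rw [← mul_div_assoc, ← sub_div]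
    gcongr
    linarith
  · intro i
    have h1 := Nat.floor_le (show 0 ≤ q * (f i : ℝ) by positivity)
    have h2 : ((⌊q * (f i : ℝ)⌋₊ - k : ℕ) : ℝ) ≤ ⌊q * (f i : ℝ)⌋₊ := by
      exact_mod_cast Nat.sub_le _ _
    simp only
    rw [← mul_div_assoc]
    gcongr
    linarith

theorem natCast_mul_mem_complexOffNonneg {x : ℂ} (hx : x ∈ complexOffNonneg) {N : ℕ}
    (hN : 0 < N) : (N : ℂ) * x ∈ complexOffNonneg := by
  rintro ⟨y, hy, h⟩
  refine mul_sub_mem_complexOffNonneg hx (u := N) (v := y) (by exact_mod_cast hN) hy ?_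
  rw [Complex.ofReal_natCast, ← h, sub_self]

theorem div_natCast_mem_shiftedSector {x y : ℂ} {N : ℕ} (hN : 0 < N)
    (hy : y ∈ shiftedSector (N * x)) : y / N ∈ shiftedSector x := by
  obtain ⟨u, v, hu, hv, rfl⟩ := hy
  have : (N : ℂ) ≠ 0 := by exact_mod_cast hN.ne'
  refine ⟨u, v / N, hu, by positivity, ?_⟩
  push_cast
  field_simp

theorem scaledParams_last {m : ℕ} (a : Fin (m + 1) → ℝ) (N : ℕ) :
    scaledParams a N (Fin.last m) = N * a (Fin.last m) := by
  simp [scaledParams]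

theorem scaledParams_of_ne {m : ℕ} (a : Fin (m + 1) → ℝ) (N : ℕ) {j : Fin (m + 1)}
    (hj : j ≠ Fin.last m) : scaledParams a N j = a j := by
  simp [scaledParams, hj]

theorem scaledParams_pos {m : ℕ} {a : Fin (m + 1) → ℝ} (ha : ∀ i, 0 < a i) {N : ℕ} (hN : 0 < N)
    (j : Fin (m + 1)) : 0 < scaledParams a N j := by
  by_cases hj : j = Fin.last m
  · subst hj
    rw [scaledParams_last]
    have := ha (Fin.last m)
    positivity
  · rw [scaledParams_of_ne a N hj]
    exact ha j

/-- `z C_n(z - 1) / (N C_n(z))` at `z = N x` for the parameters `(a_1, …, N a_r)`. -/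
noncomputable def scaledQuot {m : ℕ} (a : Fin (m + 1) → ℝ) (N : ℕ) (x : ℂ)
    (n : Fin (m + 1) → ℕ) : ℂ :=
  charlierQuot (scaledParams a N) (N * x) n / N

theorem scaledQuot_mem {m : ℕ} {a : Fin (m + 1) → ℝ} (ha : ∀ i, 0 < a i) {N : ℕ} (hN : 0 < N)
    {x : ℂ} (hx : x ∈ complexOffNonneg) (n : Fin (m + 1) → ℕ) :
    scaledQuot a N x n ∈ shiftedSector x :=
  div_natCast_mem_shiftedSector hN
    (charlierQuot_mem (scaledParams_pos ha hN) (natCast_mul_mem_complexOffNonneg hx hN) n).2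

theorem scaledQuot_eq {m : ℕ} {a : Fin (m + 1) → ℝ} (ha : ∀ i, 0 < a i) {N : ℕ} (hN : 0 < N)
    {x : ℂ} (hx : x ∈ complexOffNonneg) (n : Fin (m + 1) → ℕ) :
    scaledQuot a N x n = x - ∑ j, ((n j : ℝ) / N : ℝ) * (scaledQuot a N x (n - Pi.single j 1) /
      (scaledQuot a N x (n - Pi.single j 1) - (scaledParams a N j / N : ℝ))) := by
  have hmem := charlierQuot_mem (scaledParams_pos ha hN) (natCast_mul_mem_complexOffNonneg hx hN)
  have hN' : (N : ℂ) ≠ 0 := by exact_mod_cast hN.ne'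
  rw [scaledQuot, charlierQuot_eq (fun j _ => (hmem _).1) (hmem n).1, sub_div,
    mul_div_cancel_left₀ _ hN', Finset.sum_div]
  congr 1
  refine Finset.sum_congr rfl fun j _ => ?_
  rw [scaledQuot]
  push_cast
  rw [← sub_div, div_div_div_cancel_right₀ hN']
  ring

theorem tendsto_ratioFilter (t : ℝ) :
    Tendsto (fun p : ℕ × ℕ => p.2) (ratioFilter t) atTop ∧
      Tendsto (fun p : ℕ × ℕ => (p.1 : ℝ) / p.2) (ratioFilter t) (𝓝 t) :=
  ⟨tendsto_snd.mono_left inf_le_left, tendsto_comap.mono_left inf_le_right⟩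

/-! ### Passage to the limit -/

theorem eq_ratioLimit_add_of_backward_orbit {α κ t : ℝ} (hα : 0 < α) (hκ : 0 < κ) (hκ1 : κ < 1)
    (ht : 0 < t) {x : ℂ} (hx : x ∈ complexOffNonneg) {L : ℕ → ℂ}
    (hLmem : ∀ i, L i ∈ shiftedSector x)
    (hLrec : ∀ i, L i = x - (1 - κ) * t - κ * t * (L (i + 1) / (L (i + 1) - α))) :
    L 0 = ratioLimit α κ t x + α := by
  have hLα : ∀ i, L i - α ≠ 0 := fun i =>
    sub_ne_zero_of_mem_shiftedSector hx (hLmem i) hα.le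
  have hnot := ratioLimitConj_add_notMem hα hκ hκ1 ht hx
  have hsum := ratioLimit_add_conj α κ t x
  have hmul := ratioLimit_mul_conj (κ := κ) hα ht hx
  have hlt := norm_ratioLimitConj_lt hα hκ hκ1 ht hx
  set g := ratioLimit α κ t x
  set h := ratioLimitConj α κ t x
  -- The closed sector contains every `L i` but not `h + α`, so one radius `δ` serves for all `i`.
  obtain ⟨δ, hδ, hball⟩ := Metric.isOpen_iff.1 (isClosed_shiftedSector hx).isOpen_compl _ hnot
  have hfix : L 0 - α = g := by
    refine eq_of_backward_orbit (G := fun i => L i - α) hlt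
      (B := ‖x - (1 - κ) * t‖ + ‖(κ : ℂ) * t‖ * (1 + α / distNonneg x) + ‖(α : ℂ)‖)
      hLα ?_ ?_ hδ ?_
    · intro i
      rw [hsum, hmul]
      have := hLα (i + 1)
      rw [hLrec i]
      push_cast
      field_simp
      ring
    · intro i
      refine (norm_sub_le _ _).trans (add_le_add_left ?_ _)
      rw [hLrec i]
      refine (norm_sub_le _ _).trans (add_le_add_right ?_ _)
      rw [norm_mul]
      exact mul_le_mul_of_nonneg_left (norm_div_sub_le hx (hLmem _) hα.le) (norm_nonneg _)
    · intro i
      by_contra! hcon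
      refine hball (a := L i) ?_ (hLmem i)
      rw [Metric.mem_ball, dist_eq_norm]
      rwa [sub_add_eq_sub_sub_swap]
  exact eq_add_of_sub_eq hfix

/-- It suffices to identify the limit along every ultrafilter. The point `x` varies along with `(n,
N)`, so that local uniformity in `x` comes for free. -/
theorem tendsto_scaledQuot {m : ℕ} {a q : Fin (m + 1) → ℝ} (ha : ∀ i, 0 < a i)
    (hq : ∀ i, 0 < q i ∧ q i < 1) (hq_sum : ∑ i, q i = 1) {t : ℝ} (ht : 0 < t) {x₀ : ℂ}
    (hx₀ : x₀ ∈ complexOffNonneg) :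
    Tendsto (fun y : (ℕ × ℕ) × ℂ => scaledQuot a y.1.2 y.2 (floorIndex q y.1.1))
      (ratioFilter t ×ˢ 𝓝 x₀)
      (𝓝 (ratioLimit (a (Fin.last m)) (q (Fin.last m)) t x₀ + a (Fin.last m))) := by
  set α := a (Fin.last m) with hα
  set κ := q (Fin.last m) with hκ
  have hαpos : 0 < α := ha _
  rw [tendsto_iff_ultrafilter]
  intro U hU
  have hN : Tendsto (fun y : (ℕ × ℕ) × ℂ => y.1.2) U atTop :=
    ((tendsto_ratioFilter t).1.comp tendsto_fst).mono_left hU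
  have hnN : Tendsto (fun y : (ℕ × ℕ) × ℂ => (y.1.1 : ℝ) / y.1.2) U (𝓝 t) :=
    ((tendsto_ratioFilter t).2.comp tendsto_fst).mono_left hU
  have hx : Tendsto (fun y : (ℕ × ℕ) × ℂ => y.2) U (𝓝 x₀) := tendsto_snd.mono_left hU
  have hNr : Tendsto (fun y : (ℕ × ℕ) × ℂ => (y.1.2 : ℝ)) U atTop :=
    tendsto_natCast_atTop_atTop.comp hN
  have hgood : ∀ᶠ y in (U : Filter ((ℕ × ℕ) × ℂ)), 0 < y.1.2 ∧ y.2 ∈ complexOffNonneg :=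
    (hN.eventually_gt_atTop 0).and (hx.eventually (isOpen_complexOffNonneg.mem_nhds hx₀))
  have hd := distNonneg_pos hx₀
  have hdx : Tendsto (fun y : (ℕ × ℕ) × ℂ => distNonneg y.2) U (𝓝 (distNonneg x₀)) :=
    (continuous_distNonneg.tendsto x₀).comp hx
  -- The chain `n - i e_r`. If it truncates at `0` nothing breaks: the recurrence and the sector
  -- bound hold at every index.
  let idx : ℕ → ℕ → Fin (m + 1) → ℕ := fun i n => floorIndex q n - Pi.single (Fin.last m) i
  let Y : ℕ → (ℕ × ℕ) × ℂ → ℂ := fun i y => scaledQuot a y.1.2 y.2 (idx i y.1.1)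
  have hidx : ∀ i n, idx i n - Pi.single (Fin.last m) 1 = idx (i + 1) n := fun i n => by
    simp only [idx, tsub_tsub, ← Pi.single_add]
  have hYmem : ∀ i, ∀ᶠ y in (U : Filter ((ℕ × ℕ) × ℂ)), Y i y ∈ shiftedSector y.2 := by
    intro i
    filter_upwards [hgood] with y hy using scaledQuot_mem ha hy.1 hy.2 _
  have hcoef : ∀ i j, Tendsto (fun y : (ℕ × ℕ) × ℂ => (((idx i y.1.1 j : ℝ) / y.1.2 : ℝ) : ℂ)) U
      (𝓝 ((q j * t : ℝ) : ℂ)) := by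
    intro i j
    have h := tendsto_floor_sub_div (hq j).1.le hN hnN
      ((Pi.single (Fin.last m) i : Fin (m + 1) → ℕ) j)
    exact (Complex.continuous_ofReal.tendsto _).comp h
  have hsmall : ∀ i (j : Fin m), Tendsto (fun y : (ℕ × ℕ) × ℂ =>
      scaledQuot a y.1.2 y.2 (idx i y.1.1 - Pi.single j.castSucc 1) /
      (scaledQuot a y.1.2 y.2 (idx i y.1.1 - Pi.single j.castSucc 1) -
        (a j.castSucc / y.1.2 : ℝ))) U (𝓝 1) := by
    intro i j
    rw [tendsto_iff_norm_sub_tendsto_zero]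
    have hlim : Tendsto (fun y : (ℕ × ℕ) × ℂ => a j.castSucc / y.1.2 / distNonneg y.2) U (𝓝 0) := by
      have h := (hNr.const_div_atTop (a j.castSucc)).div hdx hd.ne'
      rwa [zero_div] at h
    refine squeeze_zero' (Eventually.of_forall fun y => norm_nonneg _) ?_ hlim
    filter_upwards [hgood] with y hy
    exact norm_div_sub_sub_one_le hy.2 (scaledQuot_mem ha hy.1 hy.2 _)
      (div_nonneg (ha _).le (Nat.cast_nonneg _))
  -- The directions other than `r` together contribute `∑_{j < r} q_j t = (1 - κ) t`.
  have hrec : ∀ i, Tendsto (fun y => Y i y + (((idx i y.1.1 (Fin.last m) : ℝ) / y.1.2 : ℝ) : ℂ) *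
      (Y (i + 1) y / (Y (i + 1) y - α))) U (𝓝 (x₀ - (1 - κ) * t)) := by
    intro i
    have h1 := hx.sub (tendsto_finsetSum Finset.univ fun (j : Fin m) _ =>
      (hcoef i j.castSucc).mul (hsmall i j))
    have h2 : ∑ j : Fin m, ((q j.castSucc * t : ℝ) : ℂ) * 1 = (1 - κ) * t := by
      rw [Fin.sum_univ_castSucc] at hq_sum
      have : ((∑ j : Fin m, q j.castSucc : ℝ) : ℂ) = ((1 - κ : ℝ) : ℂ) := by
        rw [← hq_sum, hκ]; simp
      simp only [mul_one, Complex.ofReal_mul, ← Finset.sum_mul]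
      rw [← Complex.ofReal_sum, this]
      push_cast; rfl
    rw [h2] at h1
    refine h1.congr' ?_
    filter_upwards [hgood] with y hy
    have hN' : (y.1.2 : ℝ) ≠ 0 := by exact_mod_cast hy.1.ne'
    have h3 := scaledQuot_eq ha hy.1 hy.2 (idx i y.1.1)
    rw [Fin.sum_univ_castSucc, hidx, scaledParams_last, mul_div_cancel_left₀ _ hN'] at h3
    simp only [scaledParams_of_ne a y.1.2 (Fin.castSucc_ne_last _)] at h3
    change Y i y = _ at h3
    rw [h3]
    simp only [Y]
    ring
  -- The quotient at `i + 1` is bounded, hence convergent along the ultrafilter; the recurrence then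
  -- makes `Y i` convergent.
  have hR : ∀ i, ∃ R : ℂ, Tendsto (fun y => Y (i + 1) y / (Y (i + 1) y - α)) U (𝓝 R) := by
    intro i
    refine exists_tendsto_of_eventually_norm_le (B := 1 + α / (distNonneg x₀ / 2)) ?_
    filter_upwards [hgood, hYmem (i + 1), hdx.eventually_const_lt (half_lt_self hd)] with y hy hm hdy
    refine (norm_div_sub_le hy.2 hm hαpos.le).trans ?_
    gcongr
  have hL : ∀ i, ∃ L : ℂ, Tendsto (Y i) U (𝓝 L) := by
    intro i
    obtain ⟨R, hR⟩ := hR i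
    refine ⟨_, ((hrec i).sub ((hcoef i (Fin.last m)).mul hR)).congr fun y => ?_⟩
    ring
  choose L hL using hL
  have hLmem : ∀ i, L i ∈ shiftedSector x₀ := fun i =>
    mem_shiftedSector_of_tendsto hx₀ hx (hL i) (hYmem i)
  have hLα : ∀ i, L i - α ≠ 0 := fun i =>
    sub_ne_zero_of_mem_shiftedSector hx₀ (hLmem i) hαpos.le
  have hLrec : ∀ i, L i = x₀ - (1 - κ) * t - κ * t * (L (i + 1) / (L (i + 1) - α)) := by
    intro i
    have h1 := (hL i).add ((hcoef i (Fin.last m)).mul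
      ((hL (i + 1)).div ((hL (i + 1)).sub_const (α : ℂ)) (hLα (i + 1))))
    have h2 := tendsto_nhds_unique h1 (hrec i)
    push_cast at h2
    linear_combination h2
  have h0 := hL 0
  rw [eq_ratioLimit_add_of_backward_orbit hαpos (hq _).1 (hq _).2 ht hx₀ hLmem hLrec] at h0
  simpa [Y, idx] using h0

/-! ### From the quotients to the Charlier ratios -/

theorem eventually_injective_scaledParams {m : ℕ} {a : Fin (m + 1) → ℝ} (ha : ∀ i, 0 < a i)
    (ha_ne : ∀ i j, i ≠ Fin.last m → j ≠ Fin.last m → i ≠ j → a i ≠ a j) :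
    ∀ᶠ N : ℕ in atTop, Function.Injective (scaledParams a N) := by
  have h : ∀ᶠ N : ℕ in atTop, ∀ j, a j < N * a (Fin.last m) :=
    eventually_all.2 fun j => (tendsto_natCast_atTop_atTop.atTop_mul_const
      (ha (Fin.last m))).eventually_gt_atTop (a j)
  filter_upwards [h] with N hN i j hij
  by_contra hne
  by_cases hi : i = Fin.last m
  · subst hi
    rw [scaledParams_last, scaledParams_of_ne a N (Ne.symm hne)] at hij
    exact (hN j).ne' hij
  by_cases hj : j = Fin.last m
  · subst hj
    rw [scaledParams_last, scaledParams_of_ne a N hne] at hij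
    exact (hN i).ne hij
  rw [scaledParams_of_ne a N hi, scaledParams_of_ne a N hj] at hij
  exact ha_ne i j hi hj hne hij

theorem charlierRatio_eq {m : ℕ} {a : Fin (m + 1) → ℝ} (q : Fin (m + 1) → ℝ)
    (ha : ∀ i, 0 < a i) {N : ℕ} (hN : 0 < N) (hinj : Function.Injective (scaledParams a N))
    {x : ℂ} (hx : x ∈ complexOffNonneg) (k : Fin (m + 1)) (n : ℕ) :
    charlierRatio a q k n N x =
      scaledQuot a N x (floorIndex q n) - (scaledParams a N k / N : ℝ) := by
  have hpos := scaledParams_pos ha hN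
  have h0 := (charlierQuot_mem hpos (natCast_mul_mem_complexOffNonneg hx hN) (floorIndex q n)).1
  rw [charlierRatio, multipleCharlier_eq (fun j => (hpos j).ne') hinj,
    multipleCharlier_eq (fun j => (hpos j).ne') hinj, ← fallingEval_apply, ← fallingEval_apply,
    fallingEval_umbra_add_single h0, mul_div_mul_right _ _ h0, scaledQuot]
  push_cast
  rw [sub_div]

/-- All directions `k` share the same rescaled quotient and differ only in the limit `c` of `b_k /
N`, which is `a_r` for `k = r` and `0` otherwise. On a compact set, uniform convergence follows from
joint convergence at each point and continuity of the limit. -/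
theorem tendstoUniformlyOn_charlierRatio {m : ℕ} {a q : Fin (m + 1) → ℝ} (ha : ∀ i, 0 < a i)
    (ha_ne : ∀ i j, i ≠ Fin.last m → j ≠ Fin.last m → i ≠ j → a i ≠ a j)
    (hq : ∀ i, 0 < q i ∧ q i < 1) (hq_sum : ∑ i, q i = 1) {t : ℝ} (ht : 0 < t)
    {K : Set ℂ} (hK : IsCompact K) (hK_sub : K ⊆ complexOffNonneg) (k : Fin (m + 1)) {c : ℝ}
    (hc : Tendsto (fun N : ℕ => scaledParams a N k / N) atTop (𝓝 c)) :
    TendstoUniformlyOn (fun (p : ℕ × ℕ) (x : ℂ) => charlierRatio a q k p.1 p.2 x)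
      (fun x => ratioLimit (a (Fin.last m)) (q (Fin.last m)) t x + a (Fin.last m) - c)
      (ratioFilter t) K := by
  rw [← tendstoLocallyUniformlyOn_iff_tendstoUniformlyOn_of_compact hK,
    tendstoLocallyUniformlyOn_iff_forall_tendsto]
  intro x₀ hx₀
  have hoff := hK_sub hx₀
  have hle : ratioFilter t ×ˢ 𝓝[K] x₀ ≤ ratioFilter t ×ˢ 𝓝 x₀ :=
    prod_mono le_rfl nhdsWithin_le_nhds
  refine Tendsto.mono_right (Tendsto.mono_left ?_ hle) (nhds_le_uniformity
    (ratioLimit (a (Fin.last m)) (q (Fin.last m)) t x₀ + a (Fin.last m) - c))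
  have hN : Tendsto (fun y : (ℕ × ℕ) × ℂ => y.1.2) (ratioFilter t ×ˢ 𝓝 x₀) atTop :=
    (tendsto_ratioFilter t).1.comp tendsto_fst
  refine Tendsto.prodMk_nhds ?_ ?_
  · exact ((((continuousAt_ratioLimit (ha _) (hq _).1 (hq _).2 ht hoff).tendsto).comp
      tendsto_snd).add_const _).sub_const _
  · refine ((tendsto_scaledQuot ha hq hq_sum ht hoff).sub
      ((Complex.continuous_ofReal.tendsto c).comp (hc.comp hN))).congr' ?_
    filter_upwards [hN.eventually_gt_atTop 0,
      hN.eventually (eventually_injective_scaledParams ha ha_ne),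
      tendsto_snd.eventually (isOpen_complexOffNonneg.mem_nhds hoff)] with y h1 h2 h3
    exact (charlierRatio_eq q ha h1 h2 h3 k y.1.1).symm

theorem theorem3 (m : ℕ) (a q : Fin (m + 1) → ℝ)
    (ha : ∀ i, 0 < a i)
    (ha_ne : ∀ i j, i ≠ Fin.last m → j ≠ Fin.last m → i ≠ j → a i ≠ a j)
    (hq : ∀ i, 0 < q i ∧ q i < 1) (hq_sum : ∑ i, q i = 1)
    (t : ℝ) (ht : 0 < t)
    (K : Set ℂ) (hK : IsCompact K) (hK_sub : K ⊆ complexOffNonneg) :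
    TendstoUniformlyOn (fun (p : ℕ × ℕ) (x : ℂ) => charlierRatio a q (Fin.last m) p.1 p.2 x)
        (fun x => ratioLimit (a (Fin.last m)) (q (Fin.last m)) t x) (ratioFilter t) K ∧
      ∀ k : Fin (m + 1), k ≠ Fin.last m →
        TendstoUniformlyOn (fun (p : ℕ × ℕ) (x : ℂ) => charlierRatio a q k p.1 p.2 x)
          (fun x => x - (t : ℂ) - ((a (Fin.last m) * q (Fin.last m) * t : ℝ) : ℂ) /
            ratioLimit (a (Fin.last m)) (q (Fin.last m)) t x)
          (ratioFilter t) K := by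
  constructor
  · have hc : Tendsto (fun N : ℕ => scaledParams a N (Fin.last m) / N) atTop
        (𝓝 (a (Fin.last m))) := by
      refine tendsto_const_nhds.congr' ?_
      filter_upwards [eventually_ne_atTop 0] with N hN
      rw [scaledParams_last, mul_div_cancel_left₀ _ (Nat.cast_ne_zero.2 hN)]
    simpa using tendstoUniformlyOn_charlierRatio ha ha_ne hq hq_sum ht hK hK_sub _ hc
  · intro k hk
    have hc : Tendsto (fun N : ℕ => scaledParams a N k / N) atTop (𝓝 0) := by
      simp only [scaledParams_of_ne a _ hk]
      exact tendsto_const_div_atTop_nhds_zero_nat _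
    refine (tendstoUniformlyOn_charlierRatio ha ha_ne hq hq_sum ht hK hK_sub k hc).congr_right ?_
    intro x hx
    have hoff := hK_sub hx
    have hmul := ratioLimit_mul_conj (κ := q (Fin.last m)) (ha (Fin.last m)) ht hoff
    have hsum := ratioLimit_add_conj (a (Fin.last m)) (q (Fin.last m)) t x
    have hlt := norm_ratioLimitConj_lt (ha (Fin.last m)) (hq (Fin.last m)).1 (hq (Fin.last m)).2
      ht hoff
    have hg : ratioLimit (a (Fin.last m)) (q (Fin.last m)) t x ≠ 0 :=
      norm_pos_iff.1 ((norm_nonneg _).trans_lt hlt)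
    simp only
    -- With `g h = a_r q_r t` the fraction is `h`, and `g + a_r = x - t - h`.
    rw [← hmul, mul_div_cancel_left₀ _ hg, Complex.ofReal_zero]
    linear_combination hsum
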